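/- Let $\mathcal I\subseteq\mathbb R$ be an interval with more than one point (open, closed or half-open, bounded or not), let $\mu\ge 2$ and $0\le \ell_1\le\cdots\le\ell_\mu$ be integers, and put $m=\ell_1+\cdots+\ell_\mu$. Let $N:\mathcal I\to\mathbb R^{m\times m}$ be a matrix function, partitioned into blocks $N_{ij}:\mathcal I\to\mathbb R^{\ell_i\times\ell_j}$, $1\le i,j\le\mu$, such that $N_{ij}=0$ for $i\ge j$ and such that each secondary block has full row rank, $\operatorname{rank}N_{i,i+1}(t)=\ell_i$ for all $t\in\mathcal I$ and $i=1,\dots,\mu-1$ (the set of these $N$ is called $SUT_{rows}$). Let $N^{(E_r)}\in\mathbb R^{m\times m}$ be the constant matrix with the same partition whose blocks are $N^{(E_r)}_{i,i+1}=\begin{bmatrix}0& I_{\ell_i}\end{bmatrix}\in\mathbb R^{\ell_i\times\ell_{i+1}}$ for $i=1,\dots,\mu-1$, all other blocks being zero; let $I$ be the $m\times m$ identity matrix. If $N$ is sufficiently smooth, then the pairs $\{N,I\}$ and $\{N^{(E_r)},I\}$ are equivalent. Precisely: let $n\in\{0,1,2,\dots\}\cup\{\infty\}$ and let $N$ be of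 class $C^{n+\mu-1}$ on $\mathcal I$. Then there are pointwise nonsingular matrix functions $L,K:\mathcal I\to\mathbb R^{m\times m}$, $L$ of class $C^{n}$ and $K$ of class $C^{n+1}$, such that on $\mathcal I$ $$N^{(E_r)}=L\,N\,K,\qquad I=L\,K+L\,N\,K'.$$ -/

import Mathlib

namespace DAE

/-- A matrix function is of class `C^n` on `I` when all its entries are. -/
def MatContDiffOn {a b : Type*} (n : ℕ∞) (A : ℝ → Matrix a b ℝ) (I : Set ℝ) : Prop :=
  ∀ i j, ContDiffOn ℝ (n : WithTop ℕ∞) (fun t => A t i j) I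

/-- The entrywise derivative of a matrix function on `I` (one-sided at endpoints in `I`). -/
noncomputable def matDerivWithin {a b : Type*} (A : ℝ → Matrix a b ℝ) (I : Set ℝ) (t : ℝ) :
    Matrix a b ℝ :=
  Matrix.of fun i j => derivWithin (fun s => A s i j) I t

/-- Equivalence `{E, F} ∼ {E', F'}` of pairs of square matrix functions on `I`: there are pointwise
nonsingular `L` of class `C^n` and `K` of class `C^(n+1)` with
`E' = L E K` and `F' = L F K + L E K'` on `I`.
For `n = ∞` both `L` and `K` are smooth; for `n = 0` they are just smooth enough for the
transformed pair to be defined and continuous. -/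
def PairEquiv {m : Type*} [Fintype m] [DecidableEq m] (n : ℕ∞) (I : Set ℝ)
    (E F E' F' : ℝ → Matrix m m ℝ) : Prop :=
  ∃ L K : ℝ → Matrix m m ℝ,
    MatContDiffOn n L I ∧ MatContDiffOn (n + 1) K I ∧
    (∀ t ∈ I, IsUnit (L t)) ∧ (∀ t ∈ I, IsUnit (K t)) ∧
    (∀ t ∈ I, E' t = L t * E t * K t) ∧
    (∀ t ∈ I, F' t = L t * F t * K t + L t * E t * matDerivWithin K I t)

/-- The index set of `m` rows (or columns), `m = ℓ₁ + ⋯ + ℓ_μ`, cut into blocks of sizes `ℓ i`: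
the pair `⟨i, a⟩` is the `a`-th index within the `i`-th block. -/
abbrev BlockIdx {μ : ℕ} (ℓ : Fin μ → ℕ) : Type := (i : Fin μ) × Fin (ℓ i)

/-- The block `A_{ij}`, of size `ℓ i × ℓ j`. -/
def block {μ : ℕ} {ℓ : Fin μ → ℕ} (A : Matrix (BlockIdx ℓ) (BlockIdx ℓ) ℝ) (i j : Fin μ) :
    Matrix (Fin (ℓ i)) (Fin (ℓ j)) ℝ :=
  Matrix.of fun a b => A ⟨i, a⟩ ⟨j, b⟩

/-- `N ∈ SUT(μ, ℓ₁, …, ℓ_μ)` on `I`: the blocks `N_{ij}` with `i ≥ j` vanish. -/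
def IsSUT {μ : ℕ} (ℓ : Fin μ → ℕ) (I : Set ℝ)
    (N : ℝ → Matrix (BlockIdx ℓ) (BlockIdx ℓ) ℝ) : Prop :=
  ∀ t ∈ I, ∀ i j : Fin μ, j ≤ i → block (N t) i j = 0

/-- `N ∈ SUT_rows(μ, ℓ₁, …, ℓ_μ)` on `I`: the block sizes are nondecreasing, `N ∈ SUT`, and the
secondary blocks `N_{i,i+1}` have full row rank at each point of `I`. -/
structure IsSUTRow {μ : ℕ} (ℓ : Fin μ → ℕ) (I : Set ℝ)
    (N : ℝ → Matrix (BlockIdx ℓ) (BlockIdx ℓ) ℝ) : Prop where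
  mono : Monotone ℓ
  sut : IsSUT ℓ I N
  rank_eq : ∀ t ∈ I, ∀ i j : Fin μ, (j : ℕ) = (i : ℕ) + 1 → (block (N t) i j).rank = ℓ i

/-- The constant matrix `N^(E_r)`: its only nonzero blocks are the secondary ones,
`N^(E_r)_{i,i+1} = [0  I_{ℓ i}]` of size `ℓ i × ℓ (i+1)`; that is, row `a` of this block has its
only nonzero entry, a `1`, in column `a + (ℓ (i+1) - ℓ i)`. -/
def elemRow {μ : ℕ} (ℓ : Fin μ → ℕ) : Matrix (BlockIdx ℓ) (BlockIdx ℓ) ℝ :=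
  Matrix.of fun p q =>
    if (q.1 : ℕ) = (p.1 : ℕ) + 1 ∧ (q.2 : ℕ) + ℓ p.1 = (p.2 : ℕ) + ℓ q.1 then 1 else 0

end DAE

/-!
Write `E` for `elemRow ℓ`; its transpose `Eᵀ` appears below as `secT (elemRow ℓ)`. If `K` is smooth
and block upper triangular with invertible diagonal blocks and `N K = (K + N K') E`, then
`M = K + N K'` has the same diagonal blocks as `K`, hence is invertible, and `L = M⁻¹` satisfies `L N K = E` and `L K + L N K' = 1`. So everything reduces to
solving that equation for `K`, at the cost of at most `μ - 2` derivatives of `N`.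

*Reduction of `N` by a change of basis* (`IsSUTRow.exists_mul_eq_elemRow`). There is a block upper
triangular invertible `S`, as smooth as `N`, with `N S = E`. As the secondary blocks of `N` have
full row rank, `N` has a smooth right inverse `R` (on the range of strictly triangular matrices),
and `W(s,t) = 1 + R(s) (N(t) - N(s))` satisfies `N(s) W(s,t) = N(t)` and `W(s,s) = 1`, so it is
invertible for `s` close to `t`. A product of such matrices along a path from `t₀` to `t`,
subdivided finely enough, gives `U(t)` with `N(t) U(t) = N(t₀)`. If the division points are smooth
functions of `t`, so is `U`; on a noncompact interval one goes through a sequence of smooth maps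
`ψ n` of the interval into compact subintervals which is locally eventually the identity
(`exists_transport`). There remains linear algebra at the single point `t₀`. Since the first block
column of `N` vanishes, `U` fixes the first block, so the first block column of `S` is constant.

*The fixed point equation.* With `N S = E`, a solution of
`K = S (1 - Eᵀ E) + S Eᵀ (K + N K') E` solves `N K = (K + N K') E`, because `E Eᵀ` is the projection
onto all blocks but the last. Right multiplication by `E` shifts the block columns by one, so
iterating the right-hand side fixes one more block column at each step (`iter_succ_eq`). Starting
from the constant first block column, the iteration is stationary after `μ - 1` steps; the first
step loses no derivative of `N`, each of the other `μ - 2` loses one, which leaves `K` in `C^(n+1)`.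
Invertibility of `K` and `M` is `fixedPoint_algebra`.
-/

namespace DAE

open Set Filter Topology

/-! ### Smooth matrix functions -/

section Smooth

variable {a b c : Type*} {k : ℕ∞} {I : Set ℝ}

theorem MatContDiffOn.const (A : Matrix a b ℝ) : MatContDiffOn k (fun _ => A) I :=
  fun _ _ => contDiffOn_const

theorem MatContDiffOn.mono {k' : ℕ∞} {A : ℝ → Matrix a b ℝ} (hA : MatContDiffOn k A I)
    (h : k' ≤ k) : MatContDiffOn k' A I :=
  fun i j => (hA i j).of_le (by exact_mod_cast h)

theorem MatContDiffOn.add {A B : ℝ → Matrix a b ℝ} (hA : MatContDiffOn k A I)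
    (hB : MatContDiffOn k B I) : MatContDiffOn k (fun t => A t + B t) I :=
  fun i j => (hA i j).add (hB i j)

theorem MatContDiffOn.sub {A B : ℝ → Matrix a b ℝ} (hA : MatContDiffOn k A I)
    (hB : MatContDiffOn k B I) : MatContDiffOn k (fun t => A t - B t) I :=
  fun i j => (hA i j).sub (hB i j)

theorem MatContDiffOn.mul [Fintype b] {A : ℝ → Matrix a b ℝ} {B : ℝ → Matrix b c ℝ}
    (hA : MatContDiffOn k A I) (hB : MatContDiffOn k B I) :
    MatContDiffOn k (fun t => A t * B t) I := by
  intro i j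
  simp only [Matrix.mul_apply]
  exact ContDiffOn.sum fun x _ => (hA i x).mul (hB x j)

theorem MatContDiffOn.comp {A : ℝ → Matrix a b ℝ} (hA : MatContDiffOn k A I) {f : ℝ → ℝ}
    (hf : ContDiffOn ℝ k f I) (h : MapsTo f I I) : MatContDiffOn k (fun t => A (f t)) I :=
  fun i j => (hA i j).comp hf h

theorem MatContDiffOn.continuous_comp {X : Type*} [TopologicalSpace X] {A : ℝ → Matrix a b ℝ}
    (hA : MatContDiffOn k A I) {f : X → ℝ} (hf : Continuous f) (h : ∀ x, f x ∈ I) :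
    Continuous fun x => A (f x) :=
  continuous_matrix fun i j => (hA i j).continuousOn.comp_continuous hf h

theorem MatContDiffOn.det [Fintype a] [DecidableEq a] {A : ℝ → Matrix a a ℝ}
    (hA : MatContDiffOn k A I) : ContDiffOn ℝ k (fun t => (A t).det) I := by
  simp only [Matrix.det_apply]
  exact ContDiffOn.sum fun σ _ => (contDiffOn_prod fun i _ => hA _ _).const_smul _

theorem MatContDiffOn.adjugate [Fintype a] [DecidableEq a] {A : ℝ → Matrix a a ℝ}
    (hA : MatContDiffOn k A I) : MatContDiffOn k (fun t => (A t).adjugate) I := by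
  intro i j
  simp only [Matrix.adjugate_apply]
  refine MatContDiffOn.det (A := fun t => (A t).updateRow j (Pi.single i 1)) fun p q => ?_
  by_cases hp : p = j
  · subst hp
    simpa using contDiffOn_const
  · simpa [Matrix.updateRow_ne hp] using hA p q

theorem MatContDiffOn.inv [Fintype a] [DecidableEq a] {A : ℝ → Matrix a a ℝ}
    (hA : MatContDiffOn k A I) (h : ∀ t ∈ I, IsUnit (A t)) :
    MatContDiffOn k (fun t => (A t)⁻¹) I := by
  intro i j
  simp only [Matrix.inv_def, Ring.inverse_eq_inv', Matrix.smul_apply, smul_eq_mul]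
  exact (hA.det.inv fun t ht => ((Matrix.isUnit_iff_isUnit_det _).1 (h t ht)).ne_zero).mul
    (hA.adjugate i j)

theorem MatContDiffOn.matDerivWithin (hI : UniqueDiffOn ℝ I) {A : ℝ → Matrix a b ℝ}
    (hA : MatContDiffOn (k + 1) A I) : MatContDiffOn k (matDerivWithin A I) I :=
  fun i j => (hA i j).derivWithin hI (by push_cast; exact le_rfl)

theorem uniqueDiffOn_of_ordConnected (hI : I.OrdConnected) (hI' : I.Nontrivial) :
    UniqueDiffOn ℝ I := by
  obtain ⟨x, hx, y, hy, hxy⟩ := hI'.exists_lt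
  refine uniqueDiffOn_convex hI.convex ⟨(x + y) / 2, mem_interior.2
    ⟨Ioo x y, Ioo_subset_Icc_self.trans (hI.out hx hy), isOpen_Ioo, ?_⟩⟩
  constructor <;> linarith

end Smooth

/-! ### Exhaustion of an interval by smooth maps -/

theorem isLocallyClosed_of_ordConnected {I : Set ℝ} (hI : I.OrdConnected) : IsLocallyClosed I := by
  have h := hI.isPreconnected.mem_intervals
  simp only [mem_insert_iff, mem_singleton_iff] at h
  rcases h with h | h | h | h | h | h | h | h | h | h <;> rw [h]
  · exact isClosed_Icc.isLocallyClosed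
  · exact isClosed_Ici.isLocallyClosed.inter isOpen_Iio.isLocallyClosed
  · exact isOpen_Ioi.isLocallyClosed.inter isClosed_Iic.isLocallyClosed
  · exact isOpen_Ioo.isLocallyClosed
  · exact isClosed_Ici.isLocallyClosed
  · exact isOpen_Ioi.isLocallyClosed
  · exact isClosed_Iic.isLocallyClosed
  · exact isOpen_Iio.isLocallyClosed
  · exact isOpen_univ.isLocallyClosed
  · exact isOpen_empty.isLocallyClosed

/-- Smooth self-maps `ψ n` of an interval that exhaust it: each maps the interval into a compact
subinterval, `ψ 0` is constant, and near each point `ψ n` is the identity for all large `n`. -/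
theorem exists_smooth_exhaustion {I : Set ℝ} (hI : I.OrdConnected) {t₀ : ℝ} (ht₀ : t₀ ∈ I) :
    ∃ ψ : ℕ → ℝ → ℝ, (∀ n, ContDiff ℝ (⊤ : ℕ∞) (ψ n)) ∧ (∀ t, ψ 0 t = t₀) ∧
      (∀ n, ∃ c ∈ I, ∃ d ∈ I, ∀ t ∈ I, ψ n t ∈ Icc c d) ∧
      ∀ t ∈ I, ∃ n₀, ∀ᶠ s in 𝓝 t, ∀ n ≥ n₀, ψ n s = s := by
  obtain ⟨O, Z, hO, hZ, hIOZ⟩ := isLocallyClosed_of_ordConnected hI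
  obtain ⟨w, hwO, hw, hw01⟩ := hO.exists_contDiff_support_eq (n := (⊤ : ℕ∞))
  have hw0 : ∀ t, 0 ≤ w t := fun t => (hw01 (mem_range_self t)).1
  have hw1 : ∀ t, w t ≤ 1 := fun t => (hw01 (mem_range_self t)).2
  -- `v` is positive exactly on `O` and tends to `0` at infinity, so its superlevel sets within the
  -- closed set `Z` are compact subsets of the interval.
  let v : ℝ → ℝ := fun t => w t / (1 + t ^ 2)
  have hpos : ∀ t : ℝ, 0 < 1 + t ^ 2 := fun t => by positivity
  have hv : ContDiff ℝ (⊤ : ℕ∞) v :=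
    hw.div (by fun_prop) fun t => (hpos t).ne'
  let χ : ℕ → ℝ → ℝ := fun n t => Real.smoothTransition (n * v t - 1)
  refine ⟨fun n t => t₀ + χ n t * (t - t₀), fun n => ?_, fun t => ?_, fun n => ?_, fun t ht => ?_⟩
  · have : ContDiff ℝ (⊤ : ℕ∞) (χ n) :=
      Real.smoothTransition.contDiff.comp ((contDiff_const.mul hv).sub contDiff_const)
    exact contDiff_const.add (this.mul (contDiff_id.sub contDiff_const))
  · have : χ 0 t = 0 := Real.smoothTransition.zero_of_nonpos (by simp)
    simp [this]
  · let T : Set ℝ := insert t₀ (Z ∩ {t | 1 ≤ n * v t})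
    have hTI : T ⊆ I := by
      rintro t (rfl | ⟨htZ, ht⟩)
      · exact ht₀
      · rw [hIOZ]
        refine ⟨?_, htZ⟩
        rw [← hwO]
        intro h0
        simp [v, h0] at ht
        linarith
    have hTc : IsCompact T := by
      refine IsCompact.insert ?_ _
      refine Metric.isCompact_of_isClosed_isBounded
        (hZ.inter (isClosed_le continuous_const (continuous_const.mul hv.continuous))) ?_
      refine (Metric.isBounded_closedBall (x := (0 : ℝ)) (r := n + 1)).subset ?_
      rintro t ⟨-, ht⟩
      have h1 : 1 + t ^ 2 ≤ n := by
        have h2 : (1 : ℝ) ≤ n * w t / (1 + t ^ 2) := by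
          simpa [v, mul_div_assoc] using ht
        rw [le_div_iff₀ (hpos t)] at h2
        nlinarith [hw1 t, (Nat.cast_nonneg n : (0 : ℝ) ≤ n)]
      rw [mem_closedBall_zero_iff, Real.norm_eq_abs]
      exact abs_le_of_sq_le_sq (by nlinarith [(Nat.cast_nonneg n : (0 : ℝ) ≤ n)]) (by positivity)
    have hTne : T.Nonempty := ⟨t₀, mem_insert _ _⟩
    refine ⟨sInf T, hTI (hTc.sInf_mem hTne), sSup T, hTI (hTc.sSup_mem hTne), fun t ht => ?_⟩
    have hsub : ∀ s ∈ T, s ∈ Icc (sInf T) (sSup T) := fun s hs =>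
      ⟨csInf_le hTc.bddBelow hs, le_csSup hTc.bddAbove hs⟩
    have h0 := hsub t₀ (mem_insert _ _)
    by_cases h : 1 ≤ n * v t
    · have h1 := hsub t (mem_insert_of_mem _ ⟨(hIOZ ▸ ht).2, h⟩)
      have := (convex_Icc (sInf T) (sSup T)).add_smul_sub_mem h0 h1
        ⟨Real.smoothTransition.nonneg (n * v t - 1), Real.smoothTransition.le_one (n * v t - 1)⟩
      simpa [smul_eq_mul] using this
    · have : χ n t = 0 := Real.smoothTransition.zero_of_nonpos (by linarith)
      simpa [this] using h0
  · have hvt : 0 < v t := by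
      refine div_pos (lt_of_le_of_ne (hw0 t) (Ne.symm ?_)) (hpos t)
      have : t ∈ Function.support w := hwO ▸ (hIOZ ▸ ht).1
      exact this
    obtain ⟨n₀, hn₀⟩ := exists_nat_gt (2 / v t)
    rw [div_lt_iff₀ hvt] at hn₀
    refine ⟨n₀, ?_⟩
    have hev : ∀ᶠ s in 𝓝 t, 2 < n₀ * v s :=
      (continuous_const.mul hv.continuous).continuousAt.eventually (lt_mem_nhds hn₀)
    filter_upwards [hev] with s hs n hn
    have hvs : 0 ≤ v s := div_nonneg (hw0 s) (hpos s).le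
    have : χ n s = 1 := Real.smoothTransition.one_of_one_le (by
      have : (n₀ : ℝ) ≤ n := by exact_mod_cast hn
      nlinarith)
    simp [this]

/-! ### Transport of a matrix function along an interval -/

section Transport

variable {a m : Type*} [Fintype a] [DecidableEq m] {I : Set ℝ} {k : ℕ∞}
  {N : ℝ → Matrix a m ℝ} {R : ℝ → Matrix m a ℝ}

/-- The matrix `1 + R(s) (N(t) - N(s))`. If `R` is a pointwise right inverse of `N` then
`N(s) * transit N R s t = N(t)`; moreover `transit N R s s = 1`, so that `transit N R s t` is
invertible for `t` close to `s`. -/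
def transit (N : ℝ → Matrix a m ℝ) (R : ℝ → Matrix m a ℝ) (s t : ℝ) : Matrix m m ℝ :=
  1 + R s * (N t - N s)

@[simp] theorem transit_self (s : ℝ) : transit N R s s = 1 := by simp [transit]

variable [Fintype m]

theorem mul_transit {s t : ℝ} (h : N s * R s * (N t - N s) = N t - N s) :
    N s * transit N R s t = N t := by
  rw [transit, Matrix.mul_add, Matrix.mul_one, ← Matrix.mul_assoc, h]
  abel

theorem exists_isUnit_transit (hN : MatContDiffOn k N I) (hR : MatContDiffOn k R I)
    {c d : ℝ} (hcd : Icc c d ⊆ I) :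
    ∃ δ > 0, ∀ s ∈ Icc c d, ∀ t ∈ Icc c d, |s - t| < δ → IsUnit (transit N R s t) := by
  have hc : ContinuousOn (fun x : ℝ × ℝ => (transit N R x.1 x.2).det) (Icc c d ×ˢ Icc c d) := by
    rw [continuousOn_iff_continuous_domRestrict]
    have hf1 : Continuous fun x : (Icc c d ×ˢ Icc c d : Set (ℝ × ℝ)) => x.1.1 := by fun_prop
    have hf2 : Continuous fun x : (Icc c d ×ˢ Icc c d : Set (ℝ × ℝ)) => x.1.2 := by fun_prop
    have h1 := hN.continuous_comp hf1 fun x => hcd x.2.1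
    have h2 := hN.continuous_comp hf2 fun x => hcd x.2.2
    have h3 := hR.continuous_comp hf1 fun x => hcd x.2.1
    exact (continuous_const.add (h3.matrix_mul (h2.sub h1))).matrix_det
  have hu := (isCompact_Icc.prod isCompact_Icc).uniformContinuousOn_of_continuous hc
  obtain ⟨δ, hδ, h⟩ := Metric.uniformContinuousOn_iff.1 hu 1 one_pos
  refine ⟨δ, hδ, fun s hs t ht hst => ?_⟩
  have := h (s, t) ⟨hs, ht⟩ (s, s) ⟨hs, hs⟩ (by
    rw [Prod.dist_eq, max_lt_iff]
    simp only [dist_self, Real.dist_eq]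
    exact ⟨hδ, by rwa [abs_sub_comm]⟩)
  rw [Matrix.isUnit_iff_isUnit_det, isUnit_iff_ne_zero]
  intro h0
  simp [h0] at this

/-- Transport between two maps `f`, `g` into a compact subinterval: a product of invertible matrices
`transit` along the segments from `f t` to `g t`, cut into equally many short steps for all `t`. -/
theorem exists_transport_step (hI : I.OrdConnected)
    (hN : MatContDiffOn k N I) (hR : MatContDiffOn k R I)
    (hNR : ∀ s ∈ I, ∀ t ∈ I, N s * R s * (N t - N s) = N t - N s)
    (M : Submonoid (Matrix m m ℝ)) (hM : ∀ s ∈ I, ∀ t ∈ I, transit N R s t ∈ M)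
    {f g : ℝ → ℝ} (hf : ContDiff ℝ k f) (hg : ContDiff ℝ k g) {c d : ℝ} (hc : c ∈ I) (hd : d ∈ I)
    (hfJ : ∀ t ∈ I, f t ∈ Icc c d) (hgJ : ∀ t ∈ I, g t ∈ Icc c d) :
    ∃ V : ℝ → Matrix m m ℝ, MatContDiffOn k V I ∧ (∀ t ∈ I, IsUnit (V t)) ∧ (∀ t ∈ I, V t ∈ M) ∧
      (∀ t ∈ I, N (g t) * V t = N (f t)) ∧ ∀ t, f t = g t → V t = 1 := by
  have hcd : Icc c d ⊆ I := hI.out hc hd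
  obtain ⟨δ, hδ, hunit⟩ := exists_isUnit_transit hN hR hcd
  obtain ⟨n, hn⟩ := exists_nat_gt (max ((d - c) / δ) 0)
  have hn0 : (0 : ℝ) < n := (le_max_right _ _).trans_lt hn
  have hnδ : (d - c) / n < δ := by
    rw [div_lt_iff₀ hn0, mul_comm, ← div_lt_iff₀ hδ]
    exact (le_max_left _ _).trans_lt hn
  let σ : ℕ → ℝ → ℝ := fun i t => f t + (i / n : ℝ) * (g t - f t)
  have hσ : ∀ i, ContDiff ℝ k (σ i) := fun i =>
    hf.add (contDiff_const.mul (hg.sub hf))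
  have hσJ : ∀ i ≤ n, ∀ t ∈ I, σ i t ∈ Icc c d := fun i hi t ht => by
    have := (convex_Icc c d).add_smul_sub_mem (hfJ t ht) (hgJ t ht) (t := (i / n : ℝ))
      ⟨by positivity, (div_le_one hn0).2 (by exact_mod_cast hi)⟩
    simpa [smul_eq_mul] using this
  have hstep : ∀ i, ∀ t ∈ I, |σ (i + 1) t - σ i t| < δ := fun i t ht => by
    have e : σ (i + 1) t - σ i t = (g t - f t) / n := by
      simp only [σ]; push_cast; field_simp; ring
    rw [e, abs_div, abs_of_pos hn0]
    refine lt_of_le_of_lt ?_ hnδ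
    gcongr
    have h1 := hfJ t ht
    have h2 := hgJ t ht
    rw [abs_le]
    constructor <;> linarith [h1.1, h1.2, h2.1, h2.2]
  have key : ∀ i ≤ n, ∃ V : ℝ → Matrix m m ℝ, MatContDiffOn k V I ∧ (∀ t ∈ I, IsUnit (V t)) ∧
      (∀ t ∈ I, V t ∈ M) ∧ (∀ t ∈ I, N (σ i t) * V t = N (f t)) ∧ ∀ t, f t = g t → V t = 1 := by
    intro i
    induction i with
    | zero =>
      intro _
      exact ⟨fun _ => 1, MatContDiffOn.const _, fun _ _ => isUnit_one, fun _ _ => M.one_mem,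
        fun t _ => by simp [σ], fun _ _ => rfl⟩
    | succ i ih =>
      intro hi
      obtain ⟨V, hV, hVu, hVM, hVN, hV1⟩ := ih (by omega)
      have m1 : MapsTo (σ (i + 1)) I I := fun t ht => hcd (hσJ _ hi t ht)
      have m0 : MapsTo (σ i) I I := fun t ht => hcd (hσJ _ (by omega) t ht)
      refine ⟨fun t => transit N R (σ (i + 1) t) (σ i t) * V t, ?_, fun t ht => ?_, fun t ht => ?_,
        fun t ht => ?_, fun t h => ?_⟩
      · exact (((MatContDiffOn.const 1).add ((hR.comp (hσ _).contDiffOn m1).mul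
          ((hN.comp (hσ _).contDiffOn m0).sub (hN.comp (hσ _).contDiffOn m1))))).mul hV
      · exact (hunit _ (hσJ _ hi t ht) _ (hσJ _ (by omega) t ht) (hstep i t ht)).mul (hVu t ht)
      · exact M.mul_mem (hM _ (m1 ht) _ (m0 ht)) (hVM t ht)
      · show _ * (_ * _) = _
        rw [← Matrix.mul_assoc, mul_transit (hNR _ (m1 ht) _ (m0 ht)), hVN t ht]
      · simp [σ, h, hV1 t h]
  obtain ⟨V, h1, h2, h3, h4, h5⟩ := key n le_rfl
  refine ⟨V, h1, h2, h3, fun t ht => ?_, h5⟩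
  have e : σ n t = g t := by
    simp only [σ]; rw [div_self hn0.ne']; ring
  rw [← e, h4 t ht]

/-- A matrix function `N` with a right inverse `R` (on the differences of its values) can be
made constant by a smooth invertible change of basis on the whole interval. The change of basis
stays in every submonoid which contains the matrices `transit N R s t`. -/
theorem exists_transport (hI : I.OrdConnected) {t₀ : ℝ} (ht₀ : t₀ ∈ I)
    (hN : MatContDiffOn k N I) (hR : MatContDiffOn k R I)
    (hNR : ∀ s ∈ I, ∀ t ∈ I, N s * R s * (N t - N s) = N t - N s)
    (M : Submonoid (Matrix m m ℝ)) (hM : ∀ s ∈ I, ∀ t ∈ I, transit N R s t ∈ M) :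
    ∃ U : ℝ → Matrix m m ℝ, MatContDiffOn k U I ∧ (∀ t ∈ I, IsUnit (U t)) ∧ (∀ t ∈ I, U t ∈ M) ∧
      ∀ t ∈ I, N t * U t = N t₀ := by
  obtain ⟨ψ, hψ, hψ0, hψJ, hψid⟩ := exists_smooth_exhaustion hI ht₀
  have hψk : ∀ n, ContDiff ℝ k (ψ n) := fun n => (hψ n).of_le (by exact_mod_cast le_top)
  have hV : ∀ n, ∃ V : ℝ → Matrix m m ℝ, MatContDiffOn k V I ∧ (∀ t ∈ I, IsUnit (V t)) ∧
      (∀ t ∈ I, V t ∈ M) ∧ (∀ t ∈ I, N (ψ (n + 1) t) * V t = N (ψ n t)) ∧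
      ∀ t, ψ n t = ψ (n + 1) t → V t = 1 := by
    intro n
    obtain ⟨c, hc, d, hd, h⟩ := hψJ n
    obtain ⟨c', hc', d', hd', h'⟩ := hψJ (n + 1)
    refine exists_transport_step hI hN hR hNR M hM (hψk n) (hψk (n + 1))
      (c := min c c') (d := max d d') ?_ ?_ (fun t ht => ?_) (fun t ht => ?_)
    · rcases min_choice c c' with e | e <;> rw [e] <;> assumption
    · rcases max_choice d d' with e | e <;> rw [e] <;> assumption
    · exact Icc_subset_Icc (min_le_left _ _) (le_max_left _ _) (h t ht)
    · exact Icc_subset_Icc (min_le_right _ _) (le_max_right _ _) (h' t ht)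
  choose V hVk hVu hVM hVN hV1 using hV
  let U : ℕ → ℝ → Matrix m m ℝ := fun n => Nat.rec (fun _ => 1) (fun n W t => V n t * W t) n
  have hU0 : ∀ t, U 0 t = 1 := fun _ => rfl
  have hUs : ∀ n t, U (n + 1) t = V n t * U n t := fun _ _ => rfl
  have hUk : ∀ n, MatContDiffOn k (U n) I := fun n => by
    induction n with
    | zero => exact MatContDiffOn.const 1
    | succ n ih => exact (hVk n).mul ih
  have hUu : ∀ n, ∀ t ∈ I, IsUnit (U n t) := fun n t ht => by
    induction n with
    | zero => exact isUnit_one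
    | succ n ih => exact (hVu n t ht).mul ih
  have hUM : ∀ n, ∀ t ∈ I, U n t ∈ M := fun n t ht => by
    induction n with
    | zero => exact M.one_mem
    | succ n ih => exact M.mul_mem (hVM n t ht) ih
  have hUN : ∀ n, ∀ t ∈ I, N (ψ n t) * U n t = N t₀ := fun n t ht => by
    induction n with
    | zero => rw [hU0, Matrix.mul_one, hψ0]
    | succ n ih => rw [hUs, ← Matrix.mul_assoc, hVN n t ht, ih]
  choose! n₀ hn₀ using hψid
  -- The products `U n` stabilize near each point, so their limit is as smooth as each of them.
  have hstab : ∀ t ∈ I, ∀ᶠ s in 𝓝 t, ∀ n ≥ n₀ t, U n s = U (n₀ t) s := by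
    intro t ht
    filter_upwards [hn₀ t ht] with s hs n hn
    induction n, hn using Nat.le_induction with
    | base => rfl
    | succ n hn ih =>
      rw [hUs, hV1 n s (by rw [hs n hn, hs (n + 1) (by omega)]), one_mul, ih]
  have hloc : ∀ t ∈ I, ∀ᶠ s in 𝓝[I] t, U (n₀ s) s = U (n₀ t) s := by
    intro t ht
    filter_upwards [nhdsWithin_le_nhds (hstab t ht), self_mem_nhdsWithin] with s hs hsI
    have h1 := (hstab s hsI).self_of_nhds (max (n₀ s) (n₀ t)) (le_max_left _ _)
    rw [← h1, hs _ (le_max_right _ _)]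
  refine ⟨fun t => U (n₀ t) t, fun i j t ht => ?_, fun t ht => hUu _ t ht, fun t ht => hUM _ t ht,
    fun t ht => ?_⟩
  · refine (hUk (n₀ t) i j t ht).congr_of_eventuallyEq ?_ rfl
    filter_upwards [hloc t ht] with s hs
    rw [hs]
  · have h := hUN (n₀ t) t ht
    rwa [(hn₀ t ht).self_of_nhds _ le_rfl] at h

end Transport

/-! ### Block triangular matrices -/

section BlockDegree

variable {μ : ℕ} {ℓ : Fin μ → ℕ}

/-- `A` has block degree at most `d`: the block `A_{ij}` vanishes whenever `i > j + d`. Thus degree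
`0` means block upper triangular, degree `-1` strictly block upper triangular. -/
def BlockDeg (d : ℤ) (A : Matrix (BlockIdx ℓ) (BlockIdx ℓ) ℝ) : Prop :=
  ∀ p q, ((q.1 : ℕ) : ℤ) + d < (p.1 : ℕ) → A p q = 0

/-- The vector `v` is supported in the blocks with index less than `j`. -/
def VecLT (j : ℤ) (v : BlockIdx ℓ → ℝ) : Prop :=
  ∀ p, j ≤ (p.1 : ℕ) → v p = 0

variable {A B : Matrix (BlockIdx ℓ) (BlockIdx ℓ) ℝ} {d e : ℤ}

theorem BlockDeg.mono (hA : BlockDeg d A) (h : d ≤ e) : BlockDeg e A :=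
  fun p q hpq => hA p q (by omega)

theorem BlockDeg.add (hA : BlockDeg d A) (hB : BlockDeg d B) : BlockDeg d (A + B) :=
  fun p q h => by simp [hA p q h, hB p q h]

theorem BlockDeg.sub (hA : BlockDeg d A) (hB : BlockDeg d B) : BlockDeg d (A - B) :=
  fun p q h => by simp [hA p q h, hB p q h]

theorem BlockDeg.mul (hA : BlockDeg d A) (hB : BlockDeg e B) : BlockDeg (d + e) (A * B) := by
  intro p q h
  rw [Matrix.mul_apply]
  refine Finset.sum_eq_zero fun r _ => ?_
  by_cases h1 : ((r.1 : ℕ) : ℤ) + d < (p.1 : ℕ)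
  · rw [hA p r h1, zero_mul]
  · rw [hB r q (by omega), mul_zero]

theorem blockDeg_diagonal (f : BlockIdx ℓ → ℝ) : BlockDeg 0 (Matrix.diagonal f) :=
  fun p q h => Matrix.diagonal_apply_ne _ (by rintro rfl; omega)

theorem blockDeg_one : BlockDeg 0 (1 : Matrix (BlockIdx ℓ) (BlockIdx ℓ) ℝ) := by
  rw [← Matrix.diagonal_one]
  exact blockDeg_diagonal _

theorem BlockDeg.inv (hA : BlockDeg 0 A) (hu : IsUnit A) : BlockDeg 0 A⁻¹ := by
  have h : A.BlockTriangular (fun p => p.1) := fun p q hpq =>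
    hA p q (by simpa using hpq)
  have := hu.invertible
  intro p q hpq
  exact Matrix.blockTriangular_inv_of_blockTriangular h (by
    rw [Fin.lt_def]; omega)

theorem BlockDeg.pow (hA : BlockDeg d A) (k : ℕ) : BlockDeg (k * d) (A ^ k) := by
  induction k with
  | zero => simpa using blockDeg_one
  | succ k ih =>
    rw [pow_succ]
    exact (ih.mul hA).mono (by push_cast; linarith)

theorem BlockDeg.isUnit_one_add (hA : BlockDeg (-1) A) : IsUnit (1 + A) := by
  refine IsNilpotent.isUnit_one_add ⟨μ, ?_⟩
  ext p q
  exact hA.pow μ p q (by have := q.1.2; omega)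

theorem BlockDeg.vecLT {j : ℤ} {v : BlockIdx ℓ → ℝ} (hA : BlockDeg d A) (hv : VecLT j v) :
    VecLT (j + d) (A.mulVec v) := by
  intro p hp
  refine Finset.sum_eq_zero fun q _ => ?_
  by_cases h : j ≤ (q.1 : ℕ)
  · rw [hv q h, mul_zero]
  · simp only
    rw [hA p q (by omega), zero_mul]

theorem VecLT.mono {i j : ℤ} {v : BlockIdx ℓ → ℝ} (hv : VecLT i v) (h : i ≤ j) : VecLT j v :=
  fun p hp => hv p (h.trans hp)

theorem VecLT.add {j : ℤ} {v w : BlockIdx ℓ → ℝ} (hv : VecLT j v) (hw : VecLT j w) :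
    VecLT j (v + w) :=
  fun p hp => by simp [hv p hp, hw p hp]

theorem VecLT.sub {j : ℤ} {v w : BlockIdx ℓ → ℝ} (hv : VecLT j v) (hw : VecLT j w) :
    VecLT j (v - w) :=
  fun p hp => by simp [hv p hp, hw p hp]

/-- A matrix which acts injectively on the graded pieces of the filtration by blocks is
invertible. -/
theorem isUnit_of_filtration
    (h : ∀ (j : ℕ) (v : BlockIdx ℓ → ℝ), VecLT (j + 1) v → VecLT j (A.mulVec v) → VecLT j v) :
    IsUnit A := by
  rw [← Matrix.mulVec_injective_iff_isUnit]
  refine (injective_iff_map_eq_zero A.mulVecLin).2 fun v hv => ?_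
  have hv : A.mulVec v = 0 := hv
  have key : ∀ k ≤ μ, VecLT ((μ - k : ℕ) : ℤ) v := by
    intro k
    induction k with
    | zero =>
      intro _ p hp
      have := p.1.2
      omega
    | succ k ih =>
      intro hk
      refine h _ v ((ih (by omega)).mono (by omega)) ?_
      rw [hv]
      exact fun _ _ => rfl
  have := key μ le_rfl
  ext p
  exact this p (by omega)

/-! ### Blocks -/

theorem block_mul (i k : Fin μ) : block (A * B) i k = ∑ j, block A i j * block B j k := by
  ext a b
  rw [Matrix.sum_apply]
  simp only [block, Matrix.of_apply, Matrix.mul_apply, Fintype.sum_sigma]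

theorem BlockDeg.isUnit (hA : BlockDeg 0 A) (hu : ∀ i, IsUnit (block A i i)) : IsUnit A := by
  refine isUnit_of_filtration fun j v hv hAv => ?_
  rintro ⟨i, a⟩ hp
  rcases (lt_or_eq_of_le hp) with h | h
  · exact hv ⟨i, a⟩ (by omega)
  have hinj := (Matrix.mulVec_injective_iff_isUnit.2 (hu i))
  have hz : (block A i i).mulVec (fun b => v ⟨i, b⟩) = (block A i i).mulVec 0 := by
    rw [Matrix.mulVec_zero]
    ext b
    have h0 := hAv ⟨i, b⟩ h.le
    rw [Matrix.mulVec, dotProduct, Fintype.sum_sigma, Finset.sum_eq_single i] at h0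
    · exact h0
    · intro k _ hk
      refine Finset.sum_eq_zero fun c _ => ?_
      rcases lt_or_gt_of_ne hk with hk | hk
      · rw [hA ⟨i, b⟩ ⟨k, c⟩ (by simpa using hk), zero_mul]
      · rw [hv ⟨k, c⟩ (by simp at h ⊢; omega), mul_zero]
    · simp
  exact congrFun (hinj hz) a

/-- The projection onto all blocks except the last one. -/
def upperProj (ℓ : Fin μ → ℕ) : Matrix (BlockIdx ℓ) (BlockIdx ℓ) ℝ :=
  Matrix.diagonal fun p => if (p.1 : ℕ) + 1 < μ then 1 else 0

/-- The projection onto the first block. -/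
def firstProj (ℓ : Fin μ → ℕ) : Matrix (BlockIdx ℓ) (BlockIdx ℓ) ℝ :=
  Matrix.diagonal fun p => if (p.1 : ℕ) = 0 then 1 else 0

theorem BlockDeg.upperProj_mul (hA : BlockDeg (-1) A) : upperProj ℓ * A = A := by
  ext p q
  rw [upperProj, Matrix.diagonal_mul]
  split_ifs with h
  · rw [one_mul]
  · rw [zero_mul, hA p q (by have := q.1.2; omega)]

theorem BlockDeg.mul_firstProj (hA : BlockDeg (-1) A) : A * firstProj ℓ = 0 := by
  ext p q
  rw [firstProj, Matrix.mul_diagonal]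
  split_ifs with h
  · rw [hA p q (by omega), zero_mul]; rfl
  · rw [mul_zero]; rfl

theorem block_upperProj_of_lt {i : Fin μ} (hi : (i : ℕ) + 1 < μ) :
    block (upperProj ℓ) i i = 1 := by
  ext a b
  by_cases h : a = b
  · subst h; simp [block, upperProj, hi]
  · simp [block, upperProj, Matrix.diagonal_apply, h]

theorem block_upperProj_of_not_lt {i : Fin μ} (hi : ¬ (i : ℕ) + 1 < μ) :
    block (upperProj ℓ) i i = 0 := by
  ext a b
  simp [block, upperProj, Matrix.diagonal_apply, hi]

theorem block_one (i : Fin μ) :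
    block (1 : Matrix (BlockIdx ℓ) (BlockIdx ℓ) ℝ) i i = 1 := by
  ext a b
  by_cases h : a = b
  · subst h; simp [block]
  · simp [block, Matrix.one_apply, h]

theorem isUnit_mul_transpose_of_rank {p q : ℕ} {A : Matrix (Fin p) (Fin q) ℝ} (h : A.rank = p) :
    IsUnit (A * A.transpose) := by
  rw [← Matrix.mulVec_injective_iff_isUnit]
  have h1 : (A * A.transpose).rank = p := by rw [Matrix.rank_self_mul_transpose, h]
  have hs : Function.Surjective (A * A.transpose).mulVecLin := by
    rw [← LinearMap.range_eq_top]
    refine Submodule.eq_top_of_finrank_eq ?_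
    rw [← Matrix.rank, h1]; simp
  exact LinearMap.injective_iff_surjective.2 hs

/-! ### A right inverse of a strictly triangular matrix with secondary blocks of full row rank -/

/-- The transpose of the part of `A` formed by its secondary blocks. -/
def secT (A : Matrix (BlockIdx ℓ) (BlockIdx ℓ) ℝ) : Matrix (BlockIdx ℓ) (BlockIdx ℓ) ℝ :=
  Matrix.of fun p q => if (p.1 : ℕ) = q.1 + 1 then A q p else 0

/-- The product of `A` with `secT A`, completed by the identity in the last block. -/
def gram (A : Matrix (BlockIdx ℓ) (BlockIdx ℓ) ℝ) : Matrix (BlockIdx ℓ) (BlockIdx ℓ) ℝ :=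
  A * secT A + (1 - upperProj ℓ)

theorem blockDeg_secT : BlockDeg 1 (secT A) := fun p q h => by
  rw [secT, Matrix.of_apply, if_neg (by omega)]

theorem BlockDeg.gram (hA : BlockDeg (-1) A) : BlockDeg 0 (gram A) :=
  (hA.mul blockDeg_secT).add (blockDeg_one.sub (blockDeg_diagonal _))

theorem block_secT_succ {i k : Fin μ} (h : (k : ℕ) = i + 1) :
    block (secT A) k i = (block A i k).transpose := by
  ext a b
  simp [block, secT, h]

theorem block_secT_of_ne {i k : Fin μ} (h : (k : ℕ) ≠ i + 1) : block (secT A) k i = 0 := by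
  ext a b
  simp [block, secT, h]

theorem block_mul_secT {i j : Fin μ} (h : (j : ℕ) = i + 1) :
    block (A * secT A) i i = block A i j * (block A i j).transpose := by
  rw [block_mul, Finset.sum_eq_single j]
  · rw [block_secT_succ h]
  · intro k _ hk
    rw [block_secT_of_ne (fun h' => hk (Fin.ext (h'.trans h.symm))), Matrix.mul_zero]
  · simp

theorem block_mul_secT_of_not_lt {i : Fin μ} (h : ¬ (i : ℕ) + 1 < μ) :
    block (A * secT A) i i = 0 := by
  rw [block_mul, Finset.sum_eq_zero]
  intro k _
  rw [block_secT_of_ne (by have := k.2; omega), Matrix.mul_zero]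

theorem BlockDeg.isUnit_gram (hA : BlockDeg (-1) A)
    (hr : ∀ i j : Fin μ, (j : ℕ) = (i : ℕ) + 1 → (block A i j).rank = ℓ i) :
    IsUnit (DAE.gram A) := by
  refine hA.gram.isUnit fun i => ?_
  have e : block (DAE.gram A) i i =
    block (A * secT A) i i + (block 1 i i - block (upperProj ℓ) i i) := rfl
  rw [e, block_one]
  by_cases hi : (i : ℕ) + 1 < μ
  · rw [block_upperProj_of_lt hi, sub_self, add_zero, block_mul_secT (j := ⟨i + 1, hi⟩) rfl]
    exact isUnit_mul_transpose_of_rank (hr _ _ rfl)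
  · rw [block_upperProj_of_not_lt hi, sub_zero, block_mul_secT_of_not_lt hi, zero_add]
    exact isUnit_one

/-- `secT A * (gram A)⁻¹` is a right inverse of `A` on the range of `A`, which lies in the blocks
other than the last. -/
theorem BlockDeg.mul_secT_mul_inv (hA : BlockDeg (-1) A) (hu : IsUnit (DAE.gram A)) :
    A * (secT A * (DAE.gram A)⁻¹) = upperProj ℓ := by
  have hdet := (Matrix.isUnit_iff_isUnit_det _).1 hu
  have hQ : DAE.gram A * (DAE.gram A)⁻¹ = 1 := Matrix.mul_nonsing_inv _ hdet
  have hπ : upperProj ℓ * upperProj ℓ = upperProj ℓ := by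
    simp only [upperProj, Matrix.diagonal_mul_diagonal]
    congr 1
    ext p
    split_ifs <;> simp
  have h1 : (1 - upperProj ℓ) * DAE.gram A = 1 - upperProj ℓ := by
    rw [DAE.gram, mul_add, ← mul_assoc, sub_mul, one_mul, hA.upperProj_mul, sub_self, zero_mul,
      zero_add, sub_mul, one_mul, mul_sub, mul_one, hπ, sub_self, sub_zero]
  have h2 : (1 - upperProj ℓ) * (DAE.gram A)⁻¹ = 1 - upperProj ℓ := by
    conv_lhs => rw [← h1]
    rw [mul_assoc, hQ, mul_one]
  have h3 : A * secT A = DAE.gram A - (1 - upperProj ℓ) := by rw [DAE.gram]; abel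
  rw [← mul_assoc, h3, sub_mul, hQ, h2]
  abel

end BlockDegree

/-! ### Change of basis to the elementary form -/

section Normalization

variable {μ : ℕ} {ℓ : Fin μ → ℕ}

theorem blockDeg_elemRow : BlockDeg (-1) (elemRow ℓ) := fun p q h => by
  rw [elemRow, Matrix.of_apply, if_neg (by omega)]

theorem elemRow_mul_secT (hℓ : Monotone ℓ) : elemRow ℓ * secT (elemRow ℓ) = upperProj ℓ := by
  ext ⟨i, a⟩ ⟨j, b⟩
  rw [Matrix.mul_apply]
  by_cases hi : (i : ℕ) + 1 < μ
  · have hle : ℓ i ≤ ℓ ⟨i + 1, hi⟩ := hℓ (by rw [Fin.le_def]; simp)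
    -- the position of the only nonzero entry of the row `⟨i, a⟩`
    let q₀ : BlockIdx ℓ := ⟨⟨i + 1, hi⟩, ⟨a + (ℓ ⟨i + 1, hi⟩ - ℓ i), by have := a.2; omega⟩⟩
    have h1 : elemRow ℓ ⟨i, a⟩ q₀ = 1 := by
      rw [elemRow, Matrix.of_apply, if_pos]
      exact ⟨rfl, by simp only [q₀]; omega⟩
    rw [Finset.sum_eq_single q₀, h1, one_mul]
    · by_cases h : (⟨i, a⟩ : BlockIdx ℓ) = ⟨j, b⟩
      · rw [← h, upperProj, Matrix.diagonal_apply_eq, if_pos hi, secT, Matrix.of_apply, h1,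
          if_pos rfl]
      · rw [upperProj, Matrix.diagonal_apply_ne _ h, secT, Matrix.of_apply]
        split_ifs with hj
        · rw [elemRow, Matrix.of_apply, if_neg]
          rintro ⟨-, h2⟩
          have hij : i = j := Fin.ext (by simp only [q₀] at hj; omega)
          subst hij
          refine h ?_
          congr 1
          exact Fin.ext (by simp only [q₀] at h2; omega)
        · rfl
    · rintro ⟨k, c⟩ - hq
      rw [elemRow, Matrix.of_apply, if_neg, zero_mul]
      rintro ⟨h2, h3⟩
      have hk : k = ⟨i + 1, hi⟩ := Fin.ext h2
      subst hk
      refine hq ?_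
      simp only [q₀]
      congr 1
      exact Fin.ext (by simp only at h3 ⊢; omega)
    · simp
  · rw [Finset.sum_eq_zero]
    · rw [upperProj, Matrix.diagonal_apply]
      simp [hi]
    · intro q _
      rw [elemRow, Matrix.of_apply, if_neg, zero_mul]
      have := q.1.2
      simp only
      omega

theorem rank_block_elemRow (hℓ : Monotone ℓ) {i j : Fin μ} (h : (j : ℕ) = i + 1) :
    (block (elemRow ℓ) i j).rank = ℓ i := by
  have h1 := block_mul_secT (A := elemRow ℓ) h
  rw [elemRow_mul_secT hℓ, block_upperProj_of_lt (by have := j.2; omega)] at h1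
  rw [← Matrix.rank_self_mul_transpose, ← h1, Matrix.rank_one, Fintype.card_fin]

/-- Two matrices of the same size and of full row rank differ by a change of basis in the source. -/
theorem exists_isUnit_mul_eq {p q : ℕ} {A B : Matrix (Fin p) (Fin q) ℝ} (hA : A.rank = p)
    (hB : B.rank = p) : ∃ S : Matrix (Fin q) (Fin q) ℝ, IsUnit S ∧ A * S = B := by
  have hr : ∀ {M : Matrix (Fin p) (Fin q) ℝ}, M.rank = p → LinearMap.range M.toLin' = ⊤ := by
    intro M hM
    refine Submodule.eq_top_of_finrank_eq ?_
    rw [Matrix.toLin'_apply', ← Matrix.rank, hM]; simp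
  obtain ⟨rf, hrf⟩ := A.toLin'.exists_rightInverse_of_surjective (hr hA)
  obtain ⟨rg, hrg⟩ := B.toLin'.exists_rightInverse_of_surjective (hr hB)
  have hrf' : ∀ x, A.toLin' (rf x) = x := fun x => LinearMap.congr_fun hrf x
  have hrg' : ∀ x, B.toLin' (rg x) = x := fun x => LinearMap.congr_fun hrg x
  have hk : Module.finrank ℝ (LinearMap.ker B.toLin') =
      Module.finrank ℝ (LinearMap.ker A.toLin') := by
    have h1 := A.toLin'.finrank_range_add_finrank_ker
    have h2 := B.toLin'.finrank_range_add_finrank_ker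
    rw [hr hA] at h1
    rw [hr hB] at h2
    omega
  let φ := LinearEquiv.ofFinrankEq _ _ hk
  let κ : (Fin q → ℝ) →ₗ[ℝ] LinearMap.ker B.toLin' :=
    LinearMap.codRestrict _ (LinearMap.id - rg ∘ₗ B.toLin') fun x => by
      rw [LinearMap.mem_ker, LinearMap.sub_apply, map_sub, LinearMap.comp_apply, hrg',
        LinearMap.id_apply, sub_self]
  let e : (Fin q → ℝ) →ₗ[ℝ] (Fin q → ℝ) :=
    (LinearMap.ker A.toLin').subtype ∘ₗ φ.toLinearMap ∘ₗ κ + rf ∘ₗ B.toLin'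
  have he : ∀ x, A.toLin' (e x) = B.toLin' x := fun x => by
    have h1 : A.toLin' ((φ (κ x) : LinearMap.ker A.toLin') : Fin q → ℝ) = 0 :=
      LinearMap.mem_ker.1 (φ (κ x)).2
    have h2 : e x = (φ (κ x) : Fin q → ℝ) + rf (B.toLin' x) := rfl
    rw [h2, map_add, h1, zero_add, hrf']
  have hinj : Function.Injective e := by
    refine (injective_iff_map_eq_zero e).2 fun x hx => ?_
    have h0 : B.toLin' x = 0 := by rw [← he, hx, map_zero]
    have h2 : e x = (φ (κ x) : Fin q → ℝ) + rf (B.toLin' x) := rfl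
    rw [hx, h0, map_zero, add_zero] at h2
    have h3 : κ x = 0 := φ.map_eq_zero_iff.1 (Subtype.ext h2.symm)
    have h4 : ((κ x : LinearMap.ker B.toLin') : Fin q → ℝ) = x - rg (B.toLin' x) := rfl
    rw [h3, h0, map_zero, sub_zero] at h4
    exact h4.symm
  refine ⟨LinearMap.toMatrix' e, ?_, ?_⟩
  · rw [← Matrix.mulVec_injective_iff_isUnit]
    intro x y hxy
    refine hinj ?_
    rwa [LinearMap.toMatrix'_mulVec, LinearMap.toMatrix'_mulVec] at hxy
  · refine Matrix.toLin'.injective (LinearMap.ext fun x => ?_)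
    rw [Matrix.toLin'_mul, Matrix.toLin'_toMatrix', LinearMap.comp_apply, he]

/-- A single strictly block upper triangular matrix with secondary blocks of full row rank is
brought to the form `elemRow` by a block upper triangular change of basis. -/
theorem exists_mul_eq_elemRow (hℓ : Monotone ℓ) {A : Matrix (BlockIdx ℓ) (BlockIdx ℓ) ℝ}
    (hA : BlockDeg (-1) A)
    (hr : ∀ i j : Fin μ, (j : ℕ) = (i : ℕ) + 1 → (block A i j).rank = ℓ i) :
    ∃ S, IsUnit S ∧ BlockDeg 0 S ∧ A * S = elemRow ℓ := by
  have h1 : ∀ j : Fin μ, ∃ S : Matrix (Fin (ℓ j)) (Fin (ℓ j)) ℝ, IsUnit S ∧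
      ∀ i : Fin μ, (j : ℕ) = i + 1 → block A i j * S = block (elemRow ℓ) i j := by
    intro j
    by_cases hj : (j : ℕ) = 0
    · exact ⟨1, isUnit_one, fun i hi => by omega⟩
    · have hi₀ : (j : ℕ) - 1 < μ := by have := j.2; omega
      obtain ⟨S, hS, h⟩ := exists_isUnit_mul_eq (hr ⟨j - 1, hi₀⟩ j (by simp only; omega))
        (rank_block_elemRow hℓ (i := ⟨j - 1, hi₀⟩) (j := j) (by simp only; omega))
      refine ⟨S, hS, fun i hi => ?_⟩
      have : i = ⟨j - 1, hi₀⟩ := Fin.ext (by simp only; omega)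
      rw [this, h]
  choose S hSu hS using h1
  let S₀ : Matrix (BlockIdx ℓ) (BlockIdx ℓ) ℝ := Matrix.blockDiagonal' S
  have hS₀ : BlockDeg 0 S₀ := by
    rintro ⟨i, a⟩ ⟨j, b⟩ h
    exact Matrix.blockDiagonal'_apply_ne _ _ _ (by rintro rfl; simp at h)
  have hdiag : ∀ i, block S₀ i i = S i := fun i => by
    ext a b
    exact Matrix.blockDiagonal'_apply_eq S i a b
  have hoff : ∀ i j, i ≠ j → block S₀ i j = 0 := fun i j h => by
    ext a b
    exact Matrix.blockDiagonal'_apply_ne S a b h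
  have hS₀u : IsUnit S₀ := hS₀.isUnit fun i => by rw [hdiag]; exact hSu i
  have hblock : ∀ i j, block (A * S₀) i j = block A i j * S j := fun i j => by
    rw [block_mul, Finset.sum_eq_single j, hdiag]
    · intro k _ hk
      rw [hoff k j hk, Matrix.mul_zero]
    · simp
  -- After normalizing the secondary blocks, the error `Z` lies above the secondary diagonal.
  let Z := A * S₀ - elemRow ℓ
  have hZ : BlockDeg (-2) Z := by
    rintro ⟨i, a⟩ ⟨j, b⟩ h
    simp only at h
    by_cases hij : (j : ℕ) = i + 1
    · have h2 : block (A * S₀) i j = block (elemRow ℓ) i j := by rw [hblock, hS j i hij]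
      have h3 : (A * S₀) ⟨i, a⟩ ⟨j, b⟩ = elemRow ℓ ⟨i, a⟩ ⟨j, b⟩ := congrFun (congrFun h2 a) b
      simp only [Z, Matrix.sub_apply, h3, sub_self]
    · exact ((hA.mul hS₀).sub (blockDeg_elemRow)) ⟨i, a⟩ ⟨j, b⟩ (by simp only; omega)
  have hW : BlockDeg (-1) (secT (elemRow ℓ) * Z) := (blockDeg_secT.mul hZ)
  have hu := hW.isUnit_one_add
  have hE : elemRow ℓ * (1 + secT (elemRow ℓ) * Z) = A * S₀ := by
    rw [mul_add, mul_one, ← mul_assoc, elemRow_mul_secT hℓ,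
      (hZ.mono (by norm_num)).upperProj_mul]
    simp only [Z]
    abel
  have hdeg : BlockDeg 0 (1 + secT (elemRow ℓ) * Z) :=
    blockDeg_one.add (hW.mono (by norm_num))
  refine ⟨S₀ * (1 + secT (elemRow ℓ) * Z)⁻¹, hS₀u.mul ?_, ?_, ?_⟩
  · exact (Matrix.isUnit_nonsing_inv_iff).2 hu
  · exact hS₀.mul (hdeg.inv hu)
  · rw [← mul_assoc, ← hE, mul_assoc,
      Matrix.mul_nonsing_inv _ ((Matrix.isUnit_iff_isUnit_det _).1 hu), mul_one]

theorem IsSUTRow.blockDeg {I : Set ℝ} {N : ℝ → Matrix (BlockIdx ℓ) (BlockIdx ℓ) ℝ}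
    (hN : IsSUTRow ℓ I N) {t : ℝ} (ht : t ∈ I) : BlockDeg (-1) (N t) := by
  rintro ⟨i, a⟩ ⟨j, b⟩ h
  exact congrFun (congrFun (hN.sut t ht i j (by rw [Fin.le_def]; simp only at h; omega)) a) b

theorem MatContDiffOn.secT {I : Set ℝ} {k : ℕ∞}
    {N : ℝ → Matrix (BlockIdx ℓ) (BlockIdx ℓ) ℝ} (hN : MatContDiffOn k N I) :
    MatContDiffOn k (fun t => secT (N t)) I := by
  intro p q
  by_cases h : (p.1 : ℕ) = q.1 + 1
  · simpa [DAE.secT, h] using hN q p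
  · simpa [DAE.secT, h] using contDiffOn_const

/-- A smooth block upper triangular change of basis, whose first block column is constant, brings
the whole function `N` to the form `elemRow`. -/
theorem IsSUTRow.exists_mul_eq_elemRow {I : Set ℝ} (hI : I.OrdConnected) (hne : I.Nonempty)
    {k : ℕ∞} {N : ℝ → Matrix (BlockIdx ℓ) (BlockIdx ℓ) ℝ} (hk : MatContDiffOn k N I)
    (hN : IsSUTRow ℓ I N) :
    ∃ S : ℝ → Matrix (BlockIdx ℓ) (BlockIdx ℓ) ℝ, ∃ F : Matrix (BlockIdx ℓ) (BlockIdx ℓ) ℝ,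
      MatContDiffOn k S I ∧ (∀ t ∈ I, IsUnit (S t)) ∧ (∀ t ∈ I, BlockDeg 0 (S t)) ∧
      (∀ t ∈ I, S t * firstProj ℓ = F) ∧ ∀ t ∈ I, N t * S t = elemRow ℓ := by
  obtain ⟨t₀, ht₀⟩ := hne
  have hgu : ∀ t ∈ I, IsUnit (gram (N t)) := fun t ht =>
    (hN.blockDeg ht).isUnit_gram (hN.rank_eq t ht)
  let R : ℝ → Matrix (BlockIdx ℓ) (BlockIdx ℓ) ℝ := fun t => secT (N t) * (gram (N t))⁻¹
  have hRd : ∀ t ∈ I, BlockDeg 1 (R t) := fun t ht =>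
    blockDeg_secT.mul ((hN.blockDeg ht).gram.inv (hgu t ht))
  have hsec := hk.secT
  have hR : MatContDiffOn k R I :=
    hsec.mul (((hk.mul hsec).add (MatContDiffOn.const _)).inv hgu)
  have hdiff : ∀ s ∈ I, ∀ t ∈ I, BlockDeg (-1) (N t - N s) := fun s hs t ht =>
    (hN.blockDeg ht).sub (hN.blockDeg hs)
  have hNR : ∀ s ∈ I, ∀ t ∈ I, N s * R s * (N t - N s) = N t - N s := fun s hs t ht => by
    rw [(hN.blockDeg hs).mul_secT_mul_inv (hgu s hs), (hdiff s hs t ht).upperProj_mul]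
  let M : Submonoid (Matrix (BlockIdx ℓ) (BlockIdx ℓ) ℝ) :=
    { carrier := {U | BlockDeg 0 U ∧ U * firstProj ℓ = firstProj ℓ}
      one_mem' := ⟨blockDeg_one, one_mul _⟩
      mul_mem' := fun {U V} hU hV => ⟨hU.1.mul hV.1, by rw [mul_assoc, hV.2, hU.2]⟩ }
  have hM : ∀ s ∈ I, ∀ t ∈ I, transit N R s t ∈ M := fun s hs t ht => by
    refine ⟨blockDeg_one.add ((hRd s hs).mul (hdiff s hs t ht)), ?_⟩
    rw [transit, add_mul, mul_assoc, (hdiff s hs t ht).mul_firstProj, mul_zero, add_zero, one_mul]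
  obtain ⟨U, hU, hUu, hUM, hUN⟩ := exists_transport hI ht₀ hk hR hNR M hM
  obtain ⟨S₀, hS₀u, hS₀, hS₀E⟩ :=
    DAE.exists_mul_eq_elemRow hN.mono (hN.blockDeg ht₀) (hN.rank_eq t₀ ht₀)
  have hS₀F : firstProj ℓ * (S₀ * firstProj ℓ) = S₀ * firstProj ℓ := by
    ext p q
    rw [firstProj, Matrix.diagonal_mul, Matrix.mul_diagonal]
    by_cases hp : (p.1 : ℕ) = 0
    · rw [if_pos hp, one_mul]
    · by_cases hq : (q.1 : ℕ) = 0
      · rw [hS₀ p q (by omega)]; simp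
      · simp [hq]
  refine ⟨fun t => U t * S₀, S₀ * firstProj ℓ, hU.mul (MatContDiffOn.const _),
    fun t ht => (hUu t ht).mul hS₀u, fun t ht => (hUM t ht).1.mul hS₀, fun t ht => ?_,
    fun t ht => ?_⟩
  · rw [mul_assoc, ← hS₀F, ← mul_assoc, (hUM t ht).2]
  · rw [← mul_assoc, hUN t ht, hS₀E]

end Normalization

/-! ### The fixed point equation -/

section FixedPoint

variable {μ : ℕ} {ℓ : Fin μ → ℕ}

/-- `1 - Eᵀ E` is the projection onto the kernel of `E = elemRow ℓ`. -/
theorem elemRow_mul_kerProj (hℓ : Monotone ℓ) :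
    elemRow ℓ * (1 - secT (elemRow ℓ) * elemRow ℓ) = 0 := by
  rw [mul_sub, mul_one, ← mul_assoc, elemRow_mul_secT hℓ, blockDeg_elemRow.upperProj_mul, sub_self]

/-- The pointwise algebra behind the transformation: a block upper triangular solution of the
fixed point equation `hK` satisfies `N K = (K + N D) E`, and both `K` and `K + N D` are invertible.
For invertibility, let `v` lie in the first `j` blocks and let `K v` lie in one block less. As `N D`
is strictly triangular, so does `(K + N D) v`; then `(K + N D) (E v) = N (K v)` drops by a further
block, so by induction on `j` the vector `E v` drops by one block. Now
`v = S⁻¹ K v - Eᵀ (K + N D) E v + Eᵀ E v`, and all three terms lie in one block less. -/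
theorem fixedPoint_algebra (hℓ : Monotone ℓ) {N S K D : Matrix (BlockIdx ℓ) (BlockIdx ℓ) ℝ}
    (hN : BlockDeg (-1) N) (hS : BlockDeg 0 S) (hSu : IsUnit S) (hNS : N * S = elemRow ℓ)
    (hKd : BlockDeg 0 K) (hD : BlockDeg 0 D)
    (hK : K = S * (1 - secT (elemRow ℓ) * elemRow ℓ) +
      S * secT (elemRow ℓ) * (K + N * D) * elemRow ℓ) :
    N * K = (K + N * D) * elemRow ℓ ∧ IsUnit (K + N * D) ∧ IsUnit K := by
  set E := elemRow ℓ with hE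
  set T := secT E with hT
  set C := 1 - T * E with hC
  set M := K + N * D with hMdef
  have hEd : BlockDeg (-1) E := blockDeg_elemRow
  have hTd : BlockDeg 1 T := blockDeg_secT
  have hND : BlockDeg (-1) (N * D) := hN.mul hD
  have hM : BlockDeg 0 M := hKd.add (hND.mono (by norm_num))
  have hEC : E * C = 0 := elemRow_mul_kerProj hℓ
  have hME : BlockDeg (-1) (M * E) := hM.mul hEd
  have hET : E * T = upperProj ℓ := elemRow_mul_secT hℓ
  let X := C + T * M * E
  have hKX : K = S * X := by
    conv_lhs => rw [hK]
    simp only [X, mul_add, mul_assoc]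
  have hEX : E * X = M * E := by
    simp only [X]
    rw [mul_add, hEC, zero_add, mul_assoc, ← mul_assoc E, hET, hME.upperProj_mul]
  have hSi : S⁻¹ * S = 1 := Matrix.nonsing_inv_mul _ ((Matrix.isUnit_iff_isUnit_det _).1 hSu)
  have hXK : X = S⁻¹ * K := by rw [hKX, ← mul_assoc, hSi, one_mul]
  have key : ∀ (j : ℕ) (v : BlockIdx ℓ → ℝ), VecLT j v → VecLT (j - 1) (K.mulVec v) →
      VecLT (j - 1) v := by
    intro j
    induction j with
    | zero => exact fun v hv _ p _ => hv p (by simp)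
    | succ j ih =>
      intro v hv hKv
      have hX : VecLT j (X.mulVec v) := by
        rw [hXK, ← Matrix.mulVec_mulVec]
        exact ((hS.inv hSu).vecLT hKv).mono (by push_cast; omega)
      have hEv : VecLT j (E.mulVec v) := (hEd.vecLT hv).mono (by push_cast; omega)
      have hMEv : VecLT (j - 1) (M.mulVec (E.mulVec v)) := by
        rw [Matrix.mulVec_mulVec, ← hEX, ← Matrix.mulVec_mulVec]
        exact hEd.vecLT hX
      have hKEv : VecLT (j - 1) (K.mulVec (E.mulVec v)) := by
        have e : K.mulVec (E.mulVec v) = M.mulVec (E.mulVec v) - (N * D).mulVec (E.mulVec v) := by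
          rw [hMdef, Matrix.add_mulVec, add_sub_cancel_right]
        rw [e]
        exact hMEv.sub (hND.vecLT hEv)
      have hE' : VecLT (j - 1) (E.mulVec v) := ih _ hEv hKEv
      have h1 : VecLT j (T.mulVec (E.mulVec v)) := (hTd.vecLT hE').mono (by omega)
      have h2 : VecLT j (T.mulVec (M.mulVec (E.mulVec v))) := (hTd.vecLT hMEv).mono (by omega)
      have e : v = X.mulVec v - T.mulVec (M.mulVec (E.mulVec v)) + T.mulVec (E.mulVec v) := by
        simp only [X, hC, Matrix.add_mulVec, Matrix.sub_mulVec, Matrix.one_mulVec,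
          Matrix.mulVec_mulVec, mul_assoc]
        abel
      rw [e]
      exact ((hX.sub h2).add h1).mono (by push_cast; omega)
  refine ⟨?_, isUnit_of_filtration fun j v hv hMv => ?_,
    isUnit_of_filtration fun j v hv hKv => ?_⟩
  · rw [hKX, ← mul_assoc, hNS, hEX]
  · have h := key (j + 1) v (hv.mono (by push_cast; omega))
    push_cast at h
    rw [add_sub_cancel_right] at h
    refine h ?_
    have e : K.mulVec v = M.mulVec v - (N * D).mulVec v := by
      rw [hMdef, Matrix.add_mulVec, add_sub_cancel_right]
    rw [e]
    exact hMv.sub ((hND.vecLT hv).mono (by omega))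
  · have h := key (j + 1) v (hv.mono (by push_cast; omega))
    push_cast at h
    rw [add_sub_cancel_right] at h
    exact h hKv

/-- The iteration for the transformation `K`, started at the constant `F`: its fixed points are
those of the equation `K = S (1 - Eᵀ E) + S Eᵀ (K + N K') E` with `E = elemRow ℓ`. -/
noncomputable def iter (N S : ℝ → Matrix (BlockIdx ℓ) (BlockIdx ℓ) ℝ) (I : Set ℝ)
    (F : Matrix (BlockIdx ℓ) (BlockIdx ℓ) ℝ) : ℕ → ℝ → Matrix (BlockIdx ℓ) (BlockIdx ℓ) ℝ
  | 0 => fun _ => F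
  | k + 1 => fun t => S t * (1 - secT (elemRow ℓ) * elemRow ℓ) +
      S t * secT (elemRow ℓ) * (iter N S I F k t + N t * matDerivWithin (iter N S I F k) I t) *
        elemRow ℓ

variable {I : Set ℝ} {N S : ℝ → Matrix (BlockIdx ℓ) (BlockIdx ℓ) ℝ}
  {F : Matrix (BlockIdx ℓ) (BlockIdx ℓ) ℝ}

theorem iter_succ (k : ℕ) (t : ℝ) : iter N S I F (k + 1) t =
    S t * (1 - secT (elemRow ℓ) * elemRow ℓ) +
      S t * secT (elemRow ℓ) * (iter N S I F k t + N t * matDerivWithin (iter N S I F k) I t) *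
        elemRow ℓ := rfl

theorem contDiffOn_iter (hI : UniqueDiffOn ℝ I) {n : ℕ∞}
    (hN : MatContDiffOn (n + ((μ - 1 : ℕ) : ℕ∞)) N I)
    (hS : MatContDiffOn (n + ((μ - 1 : ℕ) : ℕ∞)) S I) (k : ℕ) (hk : k ≤ μ - 1) :
    MatContDiffOn (n + ((μ - k : ℕ) : ℕ∞)) (iter N S I F k) I := by
  induction k with
  | zero => exact MatContDiffOn.const F
  | succ k ih =>
    have hle : n + ((μ - (k + 1) : ℕ) : ℕ∞) ≤ n + ((μ - 1 : ℕ) : ℕ∞) := by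
      gcongr
      omega
    have e : n + ((μ - k : ℕ) : ℕ∞) = n + ((μ - (k + 1) : ℕ) : ℕ∞) + 1 := by
      rw [show μ - k = μ - (k + 1) + 1 by omega]
      push_cast
      rw [add_assoc]
    have h := ih (by omega)
    rw [e] at h
    have hd := h.matDerivWithin hI
    have h' := h.mono (k' := n + ((μ - (k + 1) : ℕ) : ℕ∞)) le_self_add
    have hS' := hS.mono hle
    exact (hS'.mul (MatContDiffOn.const _)).add
      (((hS'.mul (MatContDiffOn.const _)).mul (h'.add ((hN.mono hle).mul hd))).mul
        (MatContDiffOn.const _))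

theorem BlockDeg.matDerivWithin {A : ℝ → Matrix (BlockIdx ℓ) (BlockIdx ℓ) ℝ} {d : ℤ}
    (hA : ∀ t ∈ I, BlockDeg d (A t)) {t : ℝ} (ht : t ∈ I) :
    BlockDeg d (matDerivWithin A I t) := by
  intro p q h
  have e : ∀ s ∈ I, (fun s => A s p q) s = (fun _ => (0 : ℝ)) s := fun s hs => hA s hs p q h
  show derivWithin (fun s => A s p q) I t = 0
  rw [derivWithin_congr e (e t ht), derivWithin_fun_const]
  rfl

theorem blockDeg_iter (hN : ∀ t ∈ I, BlockDeg (-1) (N t)) (hS : ∀ t ∈ I, BlockDeg 0 (S t))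
    (hF : BlockDeg 0 F) (k : ℕ) : ∀ t ∈ I, BlockDeg 0 (iter N S I F k t) := by
  induction k with
  | zero => exact fun _ _ => hF
  | succ k ih =>
    intro t ht
    have hM := (ih t ht).add (((hN t ht).mul (BlockDeg.matDerivWithin ih ht)).mono (by norm_num))
    have hT : BlockDeg 1 (secT (elemRow ℓ)) := blockDeg_secT
    exact ((hS t ht).mul (blockDeg_one.sub (hT.mul blockDeg_elemRow))).add
      (((((hS t ht).mul hT).mul hM).mul blockDeg_elemRow).mono (by norm_num))

/-- The `k`-th block column of the iterates does not change after `k` steps, as right multiplication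
by `elemRow` shifts block columns by one. -/
theorem iter_succ_eq (hSF : ∀ t ∈ I, S t * firstProj ℓ = F) (k : ℕ) :
    ∀ q : BlockIdx ℓ, (q.1 : ℕ) ≤ k → ∀ t ∈ I, ∀ p,
      iter N S I F (k + 1) t p q = iter N S I F k t p q := by
  induction k with
  | zero =>
    intro q hq t ht p
    have hcol : ∀ A : Matrix (BlockIdx ℓ) (BlockIdx ℓ) ℝ, (A * firstProj ℓ) p q = A p q := by
      intro A
      rw [firstProj, Matrix.mul_diagonal, if_pos (by omega), mul_one]
    rw [← hcol (iter N S I F 1 t), iter, iter, add_mul, mul_assoc _ (elemRow ℓ),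
      blockDeg_elemRow.mul_firstProj, mul_zero, add_zero, mul_assoc, sub_mul, one_mul, mul_assoc,
      blockDeg_elemRow.mul_firstProj, mul_zero, sub_zero, hSF t ht]
  | succ k ih =>
    intro q hq t ht p
    rw [iter_succ (k + 1)]
    conv_rhs => rw [iter_succ]
    rw [Matrix.add_apply, Matrix.add_apply]
    congr 1
    rw [Matrix.mul_apply, Matrix.mul_apply]
    refine Finset.sum_congr rfl fun r _ => ?_
    by_cases hr : (r.1 : ℕ) ≤ k
    · congr 1
      rw [Matrix.mul_apply, Matrix.mul_apply]
      refine Finset.sum_congr rfl fun s _ => ?_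
      congr 1
      rw [Matrix.add_apply, Matrix.add_apply, ih r hr t ht s]
      congr 1
      rw [Matrix.mul_apply, Matrix.mul_apply]
      refine Finset.sum_congr rfl fun u _ => ?_
      congr 1
      exact derivWithin_congr (fun x hx => ih r hr x hx u) (ih r hr t ht u)
    · rw [blockDeg_elemRow r q (by omega), mul_zero, mul_zero]

end FixedPoint

end DAE

theorem proposition2 (μ : ℕ) (hμ : 2 ≤ μ) (ℓ : Fin μ → ℕ)
    (I : Set ℝ) (hI : I.OrdConnected) (hI' : I.Nontrivial)
    (n : ℕ∞) (N : ℝ → Matrix (DAE.BlockIdx ℓ) (DAE.BlockIdx ℓ) ℝ)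
    (hsmooth : DAE.MatContDiffOn (n + ((μ - 1 : ℕ) : ℕ∞)) N I)
    (hN : DAE.IsSUTRow ℓ I N) :
    DAE.PairEquiv n I N (fun _ => 1) (fun _ => DAE.elemRow ℓ) (fun _ => 1) := by
  have hU := DAE.uniqueDiffOn_of_ordConnected hI hI'
  obtain ⟨S, F, hSk, hSu, hS, hSF, hNS⟩ := hN.exists_mul_eq_elemRow hI hI'.nonempty hsmooth
  obtain ⟨t₀, ht₀⟩ := hI'.nonempty
  have hF : DAE.BlockDeg 0 F := hSF t₀ ht₀ ▸ (hS t₀ ht₀).mul (DAE.blockDeg_diagonal _)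
  have hNd : ∀ t ∈ I, DAE.BlockDeg (-1) (N t) := fun t ht => hN.blockDeg ht
  let K := DAE.iter N S I F (μ - 1)
  let M : ℝ → Matrix (DAE.BlockIdx ℓ) (DAE.BlockIdx ℓ) ℝ :=
    fun t => K t + N t * DAE.matDerivWithin K I t
  have hKk : DAE.MatContDiffOn (n + 1) K I := by
    have h := DAE.contDiffOn_iter (F := F) hU hsmooth hSk (μ - 1) le_rfl
    rwa [show μ - (μ - 1) = 1 by omega, Nat.cast_one] at h
  have hMk : DAE.MatContDiffOn n M I :=
    (hKk.mono le_self_add).add ((hsmooth.mono le_self_add).mul (hKk.matDerivWithin hU))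
  have hKd := DAE.blockDeg_iter hNd hS hF (μ - 1)
  have halg := fun t ht => DAE.fixedPoint_algebra hN.mono (hNd t ht) (hS t ht) (hSu t ht)
    (hNS t ht) (hKd t ht) (DAE.BlockDeg.matDerivWithin hKd ht) (by
      ext p q
      rw [← DAE.iter_succ_eq hSF (μ - 1) q (by have := q.1.2; omega) t ht p, DAE.iter_succ])
  have hMinv : ∀ t ∈ I, (M t)⁻¹ * M t = 1 := fun t ht =>
    Matrix.nonsing_inv_mul _ ((Matrix.isUnit_iff_isUnit_det _).1 (halg t ht).2.1)
  refine ⟨fun t => (M t)⁻¹, K, hMk.inv fun t ht => (halg t ht).2.1, hKk,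
    fun t ht => Matrix.isUnit_nonsing_inv_iff.2 (halg t ht).2.1, fun t ht => (halg t ht).2.2,
    fun t ht => ?_, fun t ht => ?_⟩
  · show DAE.elemRow ℓ = (M t)⁻¹ * N t * K t
    rw [mul_assoc, (halg t ht).1, ← mul_assoc, hMinv t ht, one_mul]
  · show 1 = (M t)⁻¹ * 1 * K t + (M t)⁻¹ * N t * DAE.matDerivWithin K I t
    rw [mul_one, mul_assoc, ← mul_add, hMinv t ht]
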